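/- Let $X$ be a complex Hilbert space, let $A\subset B(X)$ be a $C^*$-subalgebra (a norm-closed, not necessarily unital, $*$-subalgebra), let $M=\overline{A}^{SOT}$ be its closure in the strong operator topology, and suppose that $\mathrm{id}_X\in M$. Let $H$ be a (right) Hilbert $A$-module, with $A$-valued inner product $\langle\cdot,\cdot\rangle$ that is linear in the second variable and norm $\|x\|=\|\langle x,x\rangle\|^{1/2}$. Let $H\bullet M$ be the Hilbert $M$-module obtained from the algebraic tensor product $H\otimes M$ over $\mathbb{C}$ with the $M$-valued form $$\Big\langle \sum_i h_i\otimes a_i,\ \sum_j x_j\otimes b_j\Big\rangle=\sum_{i,j}a_i^*\langle h_i,x_j\rangle b_j$$ by dividing out $N=\{z:\langle z,z\rangle=0\}$ and completing in the norm $\|z\|=\|\langle z,z\rangle\|^{1/2}$; regard $H$ as a subspace of $H\bullet M$ through the isometric embedding $x\mapsto x\otimes 1$. For $\xi\in H\bullet M$, $\varepsilon>0$ and a finite set $V\subset X$ put $$N_{\xi,\varepsilon,V}=\{z\in H\bullet M:\ \|\langle \xi-z,\xi-z\rangle v\|<\varepsilon\ \text{ for all } v\in V\},$$ and let $\mathcal{T}_s$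 be the topology on $H\bullet M$ generated by all the sets $N_{\xi,\varepsilon,V}$. Then the closed unit ball of $H$ is dense in the closed unit ball of $H\bullet M$ in $\mathcal{T}_s$. In particular, for each $\xi\in H\bullet M$ with $\|\xi\|\le 1$ there is a net $(z_\alpha)$ in $H$ with $\|z_\alpha\|\le 1$ such that $\langle \xi-z_\alpha,\xi-z_\alpha\rangle\to 0$ in the strong operator topology, i.e. $\lim_\alpha\|\langle \xi-z_\alpha,\xi-z_\alpha\rangle v\|=0$ for every $v\in X$. -/

import Mathlib

open scoped TensorProduct

set_option linter.unusedSectionVars false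

noncomputable section

namespace HilbertExt

variable {X : Type*} [NormedAddCommGroup X] [InnerProductSpace ℂ X] [CompleteSpace X]

/-- The closure of a `*`-subalgebra `A` of `B(X)` in the strong operator topology
(the topology of pointwise convergence on `X`), as a linear subspace of `B(X)`. -/
def sotClosure (A : NonUnitalStarSubalgebra ℂ (X →L[ℂ] X)) : Submodule ℂ (X →L[ℂ] X) :=
  ((A.toNonUnitalSubalgebra.toSubmodule.map
      (ContinuousLinearMap.toPointwiseConvergenceCLM ℂ (RingHom.id ℂ) X X).toLinearMap
    ).topologicalClosure).comap
    (ContinuousLinearMap.toPointwiseConvergenceCLM ℂ (RingHom.id ℂ) X X).toLinearMap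

/-- Membership in the strong operator closure, spelled out. -/
theorem mem_sotClosure_iff (A : NonUnitalStarSubalgebra ℂ (X →L[ℂ] X)) (T : X →L[ℂ] X) :
    T ∈ sotClosure A ↔ ∀ ε > (0 : ℝ), ∀ V : Finset X, ∃ a ∈ A, ∀ v ∈ V, ‖a v - T v‖ < ε := by
  have h0 : T ∈ sotClosure A ↔
      (⇑T) ∈ closure ((fun a : X →L[ℂ] X => (⇑a : X → X)) '' (A : Set (X →L[ℂ] X))) := by
    let toP := ContinuousLinearMap.toPointwiseConvergenceCLM ℂ (RingHom.id ℂ) X X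
    have := (PointwiseConvergenceCLM.isEmbedding_coeFn (RingHom.id ℂ) X X
      ).closure_eq_preimage_closure_image (toP '' (A : Set (X →L[ℂ] X)))
    rw [Set.image_image] at this
    have h2 : T ∈ sotClosure A ↔ toP T ∈ closure (toP '' (A : Set (X →L[ℂ] X))) := Iff.rfl
    rw [h2, this]
    rfl
  rw [h0]
  constructor
  · intro h ε hε V
    have := mem_closure_iff_nhds.mp h (Set.pi V fun v => Metric.ball (T v) ε)
      (set_pi_mem_nhds V.finite_toSet fun v _ => Metric.ball_mem_nhds _ hε)
    obtain ⟨_, h1, a, ha, rfl⟩ := this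
    exact ⟨a, ha, fun v hv => by simpa [dist_eq_norm] using h1 v hv⟩
  · intro h
    rw [mem_closure_iff_nhds]
    intro t ht
    rw [nhds_pi, Filter.mem_pi] at ht
    obtain ⟨I, hI, s, hs, hst⟩ := ht
    choose e he hes using fun v => Metric.mem_nhds_iff.mp (hs v)
    obtain ⟨ε, hε, hle⟩ : ∃ ε > (0 : ℝ), ∀ v ∈ I, ε ≤ e v := by
      rcases hI.toFinset.eq_empty_or_nonempty with h' | h'
      · exact ⟨1, one_pos, fun v hv => absurd (hI.mem_toFinset.mpr hv) (by simp [h'])⟩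
      · exact ⟨hI.toFinset.inf' h' e, (Finset.lt_inf'_iff _).mpr fun v _ => he v,
          fun v hv => Finset.inf'_le _ (hI.mem_toFinset.mpr hv)⟩
    obtain ⟨a, ha, h1⟩ := h ε hε hI.toFinset
    refine ⟨a, hst fun v hv => hes v ?_, a, ha, rfl⟩
    rw [Metric.mem_ball, dist_eq_norm]
    exact (h1 v (hI.mem_toFinset.mpr hv)).trans_le (hle v hv)

/-! ### Positivity in a concrete C⋆-algebra -/

instance instStarOrderedRing (A : NonUnitalStarSubalgebra ℂ (X →L[ℂ] X))
    [hA : IsClosed (A : Set (X →L[ℂ] X))] : StarOrderedRing A := by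
  refine StarOrderedRing.of_nonneg_iff' (fun {x y} h z => ?_) (fun x => ⟨fun h => ?_, ?_⟩)
  · have : (x : X →L[ℂ] X) ≤ y := h
    change (z : X →L[ℂ] X) + x ≤ z + y
    gcongr
  · have hx : (0 : X →L[ℂ] X) ≤ x := h
    have hsa' : IsSelfAdjoint (x : X →L[ℂ] X) := hx.isSelfAdjoint
    have hsa : IsSelfAdjoint x := Subtype.ext hsa'
    have hb : IsSelfAdjoint (cfcₙ Real.sqrt x) := cfcₙ_predicate Real.sqrt x
    refine ⟨cfcₙ Real.sqrt x, Subtype.ext ?_⟩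
    have key : ((cfcₙ Real.sqrt x : A) : X →L[ℂ] X) = cfcₙ Real.sqrt (x : X →L[ℂ] X) :=
      NonUnitalStarAlgHomClass.map_cfcₙ (S := ℂ) (NonUnitalStarSubalgebraClass.subtype A)
        Real.sqrt x (hφ := continuous_subtype_val)
    rw [hb.star_eq]
    change (x : X →L[ℂ] X) = (cfcₙ Real.sqrt x : A) * (cfcₙ Real.sqrt x : A)
    rw [key, ← cfcₙ_mul Real.sqrt Real.sqrt]
    conv_lhs => rw [← cfcₙ_id ℝ (x : X →L[ℂ] X)]
    refine cfcₙ_congr fun r hr => ?_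
    exact (Real.mul_self_sqrt (quasispectrum_nonneg_of_nonneg _ hx r hr)).symm
  · rintro ⟨s, rfl⟩
    exact star_mul_self_nonneg (s : X →L[ℂ] X)

/-- The negative part `C` of `T`, with the properties used below. -/
theorem exists_negPart {B : Type*} [NonUnitalCStarAlgebra B] [PartialOrder B] [StarOrderedRing B]
    (T : B) (hT : IsSelfAdjoint T) :
    ∃ S C : B, C = star S * S ∧ star C = C ∧ C * T = -(C * C) ∧
      (C = 0 → ∃ R, T = star R * R) := by
  have hC : 0 ≤ T⁻ := CFC.negPart_nonneg T
  obtain ⟨S, hS⟩ := CStarAlgebra.nonneg_iff_eq_star_mul_self.mp hC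
  refine ⟨S, T⁻, hS, hC.isSelfAdjoint.star_eq, ?_, fun h =>
    CStarAlgebra.nonneg_iff_eq_star_mul_self.mp ((CFC.negPart_eq_zero_iff T hT).mp h)⟩
  have h1 : T⁻ * (T⁺ - T⁻) = -(T⁻ * T⁻) := by
    rw [mul_sub, CFC.negPart_mul_posPart, zero_sub]
  rwa [CFC.posPart_sub_negPart T hT] at h1

theorem re_sum_inner_nonneg {n : Type*} [Fintype n] (T r : n → n → X →L[ℂ] X)
    (hT : ∀ i j, T i j = ∑ k, star (r k i) * r k j) (w : n → X) :
    0 ≤ (∑ i, ∑ j, inner ℂ (w i) (T i j (w j))).re := by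
  have h3 (i j : n) : inner ℂ (w i) (T i j (w j)) =
      ∑ k, inner ℂ (r k i (w i)) (r k j (w j)) := by
    have h1 : T i j (w j) = ∑ k, (ContinuousLinearMap.adjoint (r k i)) (r k j (w j)) := by
      rw [hT]
      simp [ContinuousLinearMap.star_eq_adjoint]
    rw [h1, inner_sum]
    exact Finset.sum_congr rfl fun k _ => ContinuousLinearMap.adjoint_inner_right _ _ _
  have key : ∑ i, ∑ j, inner ℂ (w i) (T i j (w j))
      = ∑ k, inner ℂ (∑ i, r k i (w i)) (∑ j, r k j (w j)) := by
    calc ∑ i, ∑ j, inner ℂ (w i) (T i j (w j))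
        = ∑ i, ∑ k, ∑ j, inner ℂ (r k i (w i)) (r k j (w j)) := by
          refine Finset.sum_congr rfl fun i _ => ?_
          exact (Finset.sum_congr rfl fun j _ => h3 i j).trans Finset.sum_comm
      _ = ∑ k, ∑ i, ∑ j, inner ℂ (r k i (w i)) (r k j (w j)) := Finset.sum_comm
      _ = _ := by
          refine Finset.sum_congr rfl fun k _ => ?_
          rw [sum_inner]
          exact Finset.sum_congr rfl fun i _ => (inner_sum _ _ _).symm
  rw [key, Complex.re_sum]
  exact Finset.sum_nonneg fun k _ => inner_self_nonneg (𝕜 := ℂ)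

/-- A hermitian matrix `T` over a C⋆-algebra all of whose compressions `∑ cᵢ⋆ Tᵢⱼ cⱼ` are
nonnegative is of the form `r⋆ r`. -/
theorem exists_factor {A : Type*} [NonUnitalCStarAlgebra A] [PartialOrder A] [StarOrderedRing A]
    {n : Type*} [Fintype n] (T : CStarMatrix n n A) (hT : IsSelfAdjoint T)
    (h : ∀ c : n → A, 0 ≤ ∑ i, ∑ j, star (c i) * T i j * c j) :
    ∃ r : n → n → A, ∀ i j, T i j = ∑ k, star (r k i) * r k j := by
  obtain ⟨S, C, hS, hCs, e, hfin⟩ := exists_negPart T hT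
  have h1 : star (S * C) * (S * C) = - (C * T * C) := by
    rw [e, neg_mul, neg_neg, star_mul, hCs, mul_assoc, ← mul_assoc (star S), ← hS, mul_assoc]
  have h2 : S * C = 0 := by
    ext i k
    have h3 := h (fun j => C j k)
    have h4 : ∑ i, ∑ j, star (C i k) * T i j * C j k = (C * T * C) k k := by
      simp only [CStarMatrix.mul_apply, Finset.sum_mul]
      rw [Finset.sum_comm]
      refine Finset.sum_congr rfl fun j _ => Finset.sum_congr rfl fun i _ => ?_
      congr 2
      conv_rhs => rw [← hCs]
      rfl
    have h5 : ∑ i, star ((S * C) i k) * (S * C) i k = (star (S * C) * (S * C)) k k := by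
      rw [CStarMatrix.mul_apply]
      rfl
    rw [h4] at h3
    rw [h1, CStarMatrix.neg_apply] at h5
    have h6 : ∑ i, star ((S * C) i k) * (S * C) i k = 0 :=
      le_antisymm (by rw [h5]; exact neg_nonpos.mpr h3)
        (Finset.sum_nonneg fun _ _ => star_mul_self_nonneg _)
    have h7 := (Finset.sum_eq_zero_iff_of_nonneg
      (fun _ _ => star_mul_self_nonneg _)).mp h6 i (Finset.mem_univ _)
    exact (CStarRing.star_mul_self_eq_zero_iff _).mp h7
  have h8 : star C * C = 0 := by
    conv_lhs => rw [hCs]; enter [1]; rw [hS]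
    rw [mul_assoc, h2, mul_zero]
  obtain ⟨R, hR⟩ := hfin ((CStarRing.star_mul_self_eq_zero_iff _).mp h8)
  refine ⟨fun k i => R k i, fun i j => ?_⟩
  rw [hR, CStarMatrix.mul_apply]
  rfl

variable (A : NonUnitalStarSubalgebra ℂ (X →L[ℂ] X))
variable {H : Type*} [NormedAddCommGroup H] [NormedSpace ℂ H] [SMul (↥A)ᵐᵒᵖ H]
  [CStarModule (↥A)ᵐᵒᵖ H]

/-- The `A`-valued inner product of the right Hilbert `A`-module `H`, regarded as `B(X)`-valued. -/
def opInner (x y : H) : X →L[ℂ] X := ((inner (↥A)ᵐᵒᵖ x y).unop : X →L[ℂ] X)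

theorem opInner_add_right (x y z : H) : opInner A x (y + z) = opInner A x y + opInner A x z := by
  simp [opInner]

theorem opInner_add_left (x y z : H) : opInner A (x + y) z = opInner A x z + opInner A y z := by
  simp [opInner]

theorem opInner_smul_right (c : ℂ) (x y : H) : opInner A x (c • y) = c • opInner A x y := by
  simp [opInner]

theorem star_opInner (x y : H) : star (opInner A x y) = opInner A y x := by
  rw [opInner, opInner, ← CStarModule.star_inner (A := (↥A)ᵐᵒᵖ) x y]
  rfl

theorem opInner_smul_left (c : ℂ) (x y : H) :
    opInner A (c • x) y = (starRingEnd ℂ c) • opInner A x y := by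
  rw [← star_opInner, opInner_smul_right, star_smul, star_opInner]
  rfl

theorem norm_opInner_self (x : H) : ‖opInner A x x‖ = ‖x‖ ^ 2 := by
  have := CStarModule.norm_eq_sqrt_norm_inner_self (A := (↥A)ᵐᵒᵖ) x
  rw [this, Real.sq_sqrt (norm_nonneg _)]
  rfl

/-- The Gram matrix of finitely many module elements is positive. -/
theorem opInner_gram_nonneg [IsClosed (A : Set (X →L[ℂ] X))] {n : Type*} [Fintype n]
    (h : n → H) (w : n → X) :
    0 ≤ (∑ i, ∑ j, inner ℂ (w i) (opInner A (h i) (h j) (w j))).re := by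
  classical
  let T : CStarMatrix n n A := CStarMatrix.ofMatrix fun i j => (inner (↥A)ᵐᵒᵖ (h i) (h j)).unop
  have hT : IsSelfAdjoint T := by
    refine CStarMatrix.ext fun i j => ?_
    change star ((inner (↥A)ᵐᵒᵖ (h j) (h i)).unop) = (inner (↥A)ᵐᵒᵖ (h i) (h j)).unop
    rw [← CStarModule.star_inner (A := (↥A)ᵐᵒᵖ) (h j) (h i)]
    rfl
  obtain ⟨R, hR⟩ := exists_factor T hT (fun c => by
    have h1 := CStarModule.inner_self_nonneg (A := (↥A)ᵐᵒᵖ)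
      (x := ∑ j, MulOpposite.op (c j) • h j)
    rw [CStarModule.inner_sum_right] at h1
    simp only [CStarModule.inner_sum_left, CStarModule.inner_op_smul_right,
      CStarModule.inner_op_smul_left] at h1
    have h2 := (MulOpposite.unop_nonneg (α := A)).mpr h1
    simp only [Finset.unop_sum, MulOpposite.unop_mul, MulOpposite.unop_star,
      MulOpposite.unop_op] at h2
    rw [Finset.sum_comm]
    simp only [Finset.sum_mul] at h2
    exact h2)
  have hR' : ∀ i j, opInner A (h i) (h j) =
      ∑ k, star (R k i : X →L[ℂ] X) * (R k j : X →L[ℂ] X) := fun i j => by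
    have h2 := congrArg (Subtype.val) (hR i j)
    change opInner A (h i) (h j) = _ at h2
    rw [h2]
    simp
  exact re_sum_inner_nonneg _ (fun k i => (R k i : X →L[ℂ] X)) hR' w

/-- `opInner` as a sesquilinear map (conjugate-linear in the first variable). -/
def opInnerₛₗ : H →ₗ⋆[ℂ] H →ₗ[ℂ] (X →L[ℂ] X) :=
  LinearMap.mk₂'ₛₗ (starRingEnd ℂ) (RingHom.id ℂ) (opInner A)
    (opInner_add_left A) (opInner_smul_left A) (opInner_add_right A) (opInner_smul_right A)

variable (H) in
/-- The algebraic tensor product `H ⊗ M` over `ℂ`, where `M` is the strong operator closure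
of `A`. It carries the seminorm coming from the `M`-valued inner product `tensorInner`. -/
def AlgTensor : Type _ := H ⊗[ℂ] (sotClosure A)

instance : AddCommGroup (AlgTensor A H) := inferInstanceAs (AddCommGroup (H ⊗[ℂ] (sotClosure A)))

instance : Module ℂ (AlgTensor A H) := inferInstanceAs (Module ℂ (H ⊗[ℂ] (sotClosure A)))

/-- The elementary tensor `x ⊗ b` in `H ⊗ M`. -/
def tmul (x : H) (b : sotClosure A) : AlgTensor A H := x ⊗ₜ[ℂ] b

theorem AlgTensor.induction {p : AlgTensor A H → Prop} (z : AlgTensor A H) (h0 : p 0)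
    (h1 : ∀ x b, p (tmul A x b)) (h2 : ∀ z w, p z → p w → p (z + w)) : p z :=
  TensorProduct.induction_on (motive := p) z h0 h1 h2

/-- The sesquilinear form `⟨x ⊗ a, y ⊗ b⟩ = a⋆ ⟨x, y⟩ b` on `H ⊗ M`. -/
def tensorInnerAux :
    H ⊗[ℂ] (sotClosure A) →ₗ⋆[ℂ] H ⊗[ℂ] (sotClosure A) →ₗ[ℂ] (X →L[ℂ] X) :=
  TensorProduct.lift <|
    LinearMap.mk₂'ₛₗ (starRingEnd ℂ) (starRingEnd ℂ)
      (fun (x : H) (a : sotClosure A) =>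
        TensorProduct.lift (LinearMap.mk₂ ℂ
          (fun (y : H) (b : sotClosure A) =>
            star (a : X →L[ℂ] X) * opInner A x y * (b : X →L[ℂ] X))
          (fun y y' b => by simp [opInner_add_right, mul_add, add_mul])
          (fun c y b => by simp [opInner_smul_right])
          (fun y b b' => by simp [mul_add])
          (fun c y b => by simp)))
      (fun x x' a => TensorProduct.ext' fun y b => by simp [opInner_add_left, mul_add, add_mul])
      (fun c x a => TensorProduct.ext' fun y b => by simp [opInner_smul_left])
      (fun x a a' => TensorProduct.ext' fun y b => by simp [add_mul])
      (fun c x a => TensorProduct.ext' fun y b => by simp)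

variable (H) in
/-- The `M`-valued inner product on `H ⊗ M`, regarded as `B(X)`-valued:
`⟨x ⊗ a, y ⊗ b⟩ = a⋆ ⟨x, y⟩ b`, conjugate-linear in the first variable. -/
def tensorInner : AlgTensor A H →ₗ⋆[ℂ] AlgTensor A H →ₗ[ℂ] (X →L[ℂ] X) :=
  tensorInnerAux A

theorem tensorInner_tmul (x y : H) (a b : sotClosure A) :
    tensorInner A H (tmul A x a) (tmul A y b) =
      star (a : X →L[ℂ] X) * opInner A x y * (b : X →L[ℂ] X) := rfl

theorem star_tensorInner (z w : AlgTensor A H) :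
    star (tensorInner A H z w) = tensorInner A H w z := by
  induction z using AlgTensor.induction with
  | h0 => simp
  | h2 z z' hz hz' => simp [hz, hz']
  | h1 x a =>
    induction w using AlgTensor.induction with
    | h0 => simp
    | h2 w w' hw hw' => simp [hw, hw']
    | h1 y b => simp [tensorInner_tmul, star_opInner, mul_assoc]

/-- The form `⟨x ⊗ u, y ⊗ v⟩ = ⟨u, ⟨x, y⟩ v⟩` on `H ⊗ X`. -/
def vecForm : H ⊗[ℂ] X →ₗ⋆[ℂ] H ⊗[ℂ] X →ₗ[ℂ] ℂ :=
  TensorProduct.lift <|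
    LinearMap.mk₂'ₛₗ (starRingEnd ℂ) (starRingEnd ℂ)
      (fun (x : H) (u : X) =>
        (TensorProduct.lift (LinearMap.mk₂ ℂ
          (fun (y : H) (v : X) => inner ℂ u (opInner A x y v))
          (fun y y' b => by simp [opInner_add_right])
          (fun c y b => by simp [opInner_smul_right])
          (fun y b b' => by simp)
          (fun c y b => by simp)) : H ⊗[ℂ] X →ₗ[ℂ] ℂ))
      (fun x x' a => TensorProduct.ext' fun y b => by simp [opInner_add_left])
      (fun c x a => TensorProduct.ext' fun y b => by simp [opInner_smul_left])
      (fun x a a' => TensorProduct.ext' fun y b => by simp)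
      (fun c x a => TensorProduct.ext' fun y b => by simp [mul_comm])

theorem vecForm_tmul (x y : H) (u v : X) :
    vecForm A (x ⊗ₜ[ℂ] u) (y ⊗ₜ[ℂ] v) = inner ℂ u (opInner A x y v) := rfl

theorem vecForm_symm (s t : H ⊗[ℂ] X) : starRingEnd ℂ (vecForm A t s) = vecForm A s t := by
  induction s using TensorProduct.induction_on with
  | zero => simp
  | add s s' h h' => simp [h, h']
  | tmul x u =>
    induction t using TensorProduct.induction_on with
    | zero => simp
    | add s s' h h' => simp [h, h']
    | tmul y v =>
      rw [vecForm_tmul, vecForm_tmul, inner_conj_symm, ← star_opInner A x y,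
        ContinuousLinearMap.star_eq_adjoint, ContinuousLinearMap.adjoint_inner_left]

theorem vecForm_self_nonneg [IsClosed (A : Set (X →L[ℂ] X))] (s : H ⊗[ℂ] X) :
    0 ≤ (vecForm A s s).re := by
  obtain ⟨S, rfl⟩ := TensorProduct.exists_finset s
  have := opInner_gram_nonneg A (fun i : S => i.1.1) (fun i : S => i.1.2)
  simp only [map_sum, LinearMap.sum_apply, vecForm_tmul]
  rw [Finset.sum_comm]
  convert! this using 2
  rw [← Finset.sum_coe_sort]
  refine Finset.sum_congr rfl fun i _ => ?_
  rw [← Finset.sum_coe_sort]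

theorem vecForm_cauchy [IsClosed (A : Set (X →L[ℂ] X))] (s t : H ⊗[ℂ] X) :
    ‖vecForm A s t‖ ^ 2 ≤ (vecForm A s s).re * (vecForm A t t).re := by
  let core : PreInnerProductSpace.Core ℂ (H ⊗[ℂ] X) :=
    { inner := fun s t => vecForm A s t
      conj_inner_symm := fun s t => vecForm_symm A s t
      re_inner_nonneg := vecForm_self_nonneg A
      add_left := fun s s' t => by simp
      smul_left := fun s t c => by simp }
  have h := @InnerProductSpace.Core.inner_mul_inner_self_le ℂ (H ⊗[ℂ] X) _ _ _ core s t
  change ‖vecForm A s t‖ * ‖vecForm A t s‖ ≤ _ at h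
  rw [← vecForm_symm A t s, RCLike.norm_conj, ← sq] at h
  exact h

/-- The map `x ⊗ b ↦ x ⊗ b v` from `H ⊗ M` to `H ⊗ X`. -/
def evalVec (v : X) : AlgTensor A H →ₗ[ℂ] H ⊗[ℂ] X :=
  LinearMap.lTensor H (((ContinuousLinearMap.apply ℂ X v).toLinearMap).comp
    (sotClosure A).subtype)

theorem inner_tensorInner (z w : AlgTensor A H) (u v : X) :
    inner ℂ u (tensorInner A H z w v) = vecForm A (evalVec A u z) (evalVec A v w) := by
  induction z using AlgTensor.induction with
  | h0 => simp
  | h2 z z' h h' => simp [h, h']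
  | h1 x a =>
    induction w using AlgTensor.induction with
    | h0 => simp
    | h2 w w' h h' => simp [h, h']
    | h1 y b =>
      rw [tensorInner_tmul, ContinuousLinearMap.star_eq_adjoint]
      exact ContinuousLinearMap.adjoint_inner_right _ _ _

/-- The seminorm `‖z‖ = ‖⟨z, z⟩‖^(1/2)` on `H ⊗ M`. -/
instance : Norm (AlgTensor A H) := ⟨fun z => √‖tensorInner A H z z‖⟩

theorem norm_sq_algTensor (z : AlgTensor A H) : ‖z‖ ^ 2 = ‖tensorInner A H z z‖ :=
  Real.sq_sqrt (norm_nonneg _)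

theorem algTensor_norm_nonneg (z : AlgTensor A H) : 0 ≤ ‖z‖ := Real.sqrt_nonneg _

section Closed

variable [IsClosed (A : Set (X →L[ℂ] X))]

theorem vecForm_evalVec_le (z : AlgTensor A H) (u : X) :
    (vecForm A (evalVec A u z) (evalVec A u z)).re ≤ (‖z‖ * ‖u‖) ^ 2 := by
  rw [← inner_tensorInner, mul_pow, norm_sq_algTensor]
  calc (inner ℂ u (tensorInner A H z z u)).re ≤ ‖inner ℂ u (tensorInner A H z z u)‖ :=
        Complex.re_le_norm _
    _ ≤ ‖u‖ * ‖tensorInner A H z z u‖ := norm_inner_le_norm _ _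
    _ ≤ ‖u‖ * (‖tensorInner A H z z‖ * ‖u‖) := by
        gcongr; exact ContinuousLinearMap.le_opNorm _ _
    _ = _ := by ring

theorem norm_tensorInner_le (z w : AlgTensor A H) : ‖tensorInner A H z w‖ ≤ ‖z‖ * ‖w‖ := by
  have hz := algTensor_norm_nonneg A z
  have hw := algTensor_norm_nonneg A w
  refine ContinuousLinearMap.opNorm_le_bound _ (by positivity) fun v => ?_
  set y := tensorInner A H z w v with hy
  have h1 : ‖y‖ ^ 2 ≤ (‖z‖ * ‖y‖) * (‖w‖ * ‖v‖) := by
    have h2 := vecForm_cauchy A (evalVec A y z) (evalVec A v w)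
    rw [← inner_tensorInner, ← hy] at h2
    have h3 : (‖y‖ ^ 2) ^ 2 ≤ ((‖z‖ * ‖y‖) * (‖w‖ * ‖v‖)) ^ 2 := by
      calc (‖y‖ ^ 2) ^ 2 = ‖inner ℂ y y‖ ^ 2 := by
            rw [inner_self_eq_norm_sq_to_K]; simp
        _ ≤ _ := h2
        _ ≤ (‖z‖ * ‖y‖) ^ 2 * (‖w‖ * ‖v‖) ^ 2 := by
            gcongr
            · exact vecForm_self_nonneg A _
            · exact vecForm_evalVec_le A z y
            · exact vecForm_evalVec_le A w v
        _ = _ := by ring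
    exact (pow_le_pow_iff_left₀ (by positivity) (by positivity) two_ne_zero).mp h3
  rcases (norm_nonneg y).eq_or_lt with h | h
  · rw [← h]; positivity
  · nlinarith

theorem algTensorCore : SeminormedSpace.Core ℂ (AlgTensor A H) where
  norm_nonneg := algTensor_norm_nonneg A
  norm_smul c z := by
    have hz := algTensor_norm_nonneg A z
    refine (pow_left_inj₀ (algTensor_norm_nonneg A _) (by positivity) two_ne_zero).mp ?_
    rw [mul_pow, norm_sq_algTensor, norm_sq_algTensor]
    simp [norm_smul, sq, mul_assoc]
  norm_triangle z w := by
    have hz := algTensor_norm_nonneg A z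
    have hw := algTensor_norm_nonneg A w
    refine (pow_le_pow_iff_left₀ (algTensor_norm_nonneg A _) (by positivity) two_ne_zero).mp ?_
    rw [norm_sq_algTensor]
    have h1 : tensorInner A H (z + w) (z + w) = tensorInner A H z z + tensorInner A H z w
        + tensorInner A H w z + tensorInner A H w w := by simp; abel
    rw [h1]
    refine (norm_add₄_le).trans ?_
    have := norm_tensorInner_le A z w
    have := norm_tensorInner_le A w z
    have := norm_sq_algTensor A z
    have := norm_sq_algTensor A w
    nlinarith

instance : SeminormedAddCommGroup (AlgTensor A H) := SeminormedAddCommGroup.ofCore (algTensorCore A)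

instance : NormedSpace ℂ (AlgTensor A H) where
  norm_smul_le c z := ((algTensorCore A).norm_smul c z).le

theorem continuous_tensorInner :
    Continuous fun p : AlgTensor A H × AlgTensor A H => tensorInner A H p.1 p.2 := by
  let f : AlgTensor A H →L⋆[ℂ] AlgTensor A H →L[ℂ] (X →L[ℂ] X) :=
    LinearMap.mkContinuous₂ (tensorInner A H) 1 fun z w => by simpa using norm_tensorInner_le A z w
  have hf : Continuous fun p : AlgTensor A H × AlgTensor A H => f p.1 p.2 :=
    (f.continuous.comp continuous_fst).clm_apply continuous_snd
  exact hf

instance : Inner (X →L[ℂ] X) (AlgTensor A H) := ⟨fun z w => tensorInner A H z w⟩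

variable (H) in
/-- The extension `H • M` of `H` to a Hilbert `M`-module: the completion of `(H ⊗ M) / N`, where
`N` consists of the vectors `z` with `⟨z, z⟩ = 0`. (The completion of the seminormed space `H ⊗ M`
is Hausdorff, so it identifies the elements of `N` with `0`.) The inner product, again regarded as
`B(X)`-valued, is the continuous extension of the one on `H ⊗ M`. -/
abbrev Ext : Type _ := UniformSpace.Completion (AlgTensor A H)

theorem inner_coe (z w : AlgTensor A H) :
    inner (X →L[ℂ] X) (z : Ext A H) (w : Ext A H) = tensorInner A H z w :=
  (UniformSpace.Completion.isDenseInducing_coe.prodMap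
    UniformSpace.Completion.isDenseInducing_coe).extend_eq (continuous_tensorInner A) (z, w)

theorem continuous_inner :
    Continuous fun p : Ext A H × Ext A H => inner (X →L[ℂ] X) p.1 p.2 := by
  let f : AlgTensor A H →+ AlgTensor A H →+ (X →L[ℂ] X) :=
    { toFun := fun z => (tensorInner A H z).toAddMonoidHom
      map_zero' := by ext1 w; simp
      map_add' := fun z z' => by ext1 w; simp }
  have hf : Continuous fun p : AlgTensor A H × AlgTensor A H => f p.1 p.2 :=
    continuous_tensorInner A
  exact (UniformSpace.Completion.isDenseInducing_toCompl (AlgTensor A H)).extend_Z_bilin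
    (UniformSpace.Completion.isDenseInducing_toCompl (AlgTensor A H)) hf

theorem norm_sq_ext (ξ : Ext A H) : ‖ξ‖ ^ 2 = ‖inner (X →L[ℂ] X) ξ ξ‖ := by
  induction ξ using UniformSpace.Completion.induction_on with
  | hp => exact isClosed_eq (by fun_prop)
            ((continuous_inner A).comp (continuous_id.prodMk continuous_id)).norm
  | ih z => rw [UniformSpace.Completion.norm_coe, inner_coe, norm_sq_algTensor]

/-- The canonical isometric embedding `x ↦ x ⊗ 1` of `H` into `H • M`, when `M` contains the
identity operator. -/
def embed (h1 : (1 : X →L[ℂ] X) ∈ sotClosure A) : H →ₗᵢ[ℂ] Ext A H where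
  toFun x := ((tmul A x ⟨1, h1⟩ : AlgTensor A H) : Ext A H)
  map_add' x y := by
    rw [← UniformSpace.Completion.coe_add]
    exact congrArg _ (TensorProduct.add_tmul _ _ _)
  map_smul' c x := by
    rw [RingHom.id_apply, ← UniformSpace.Completion.coe_smul]
    rfl
  norm_map' x := by
    change ‖((tmul A x ⟨1, h1⟩ : AlgTensor A H) : Ext A H)‖ = ‖x‖
    rw [UniformSpace.Completion.norm_coe]
    refine (pow_left_inj₀ (algTensor_norm_nonneg A _) (norm_nonneg x) two_ne_zero).mp ?_
    rw [norm_sq_algTensor, tensorInner_tmul, star_one, one_mul, mul_one, norm_opInner_self]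

/-- The set `N_{ξ, ε, V}` of all `z` in `H • M` with `‖⟨ξ - z, ξ - z⟩ v‖ < ε` for `v ∈ V`. -/
def nhd (ξ : Ext A H) (ε : ℝ) (V : Finset X) : Set (Ext A H) :=
  {z | ∀ v ∈ V, ‖inner (X →L[ℂ] X) (ξ - z) (ξ - z) v‖ < ε}

variable (H) in
/-- The topology `T_s` on `H • M` generated by the sets `N_{ξ, ε, V}`. -/
@[reducible] def topologyTs : TopologicalSpace (Ext A H) :=
  TopologicalSpace.generateFrom {N | ∃ ξ : Ext A H, ∃ ε > (0 : ℝ), ∃ V : Finset X, N = nhd A ξ ε V}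

end Closed

end HilbertExt

end

/-!
Let `K = H ⊗_A X` be the completion of `H ⊗ X` for the form `⟨x ⊗ u, y ⊗ v⟩ = ⟨u, ⟨x, y⟩ v⟩`. An
element `ξ` of `H • M` acts as an operator `moduleOp ξ : X → K`; this is isometric, and
`⟨ξ, η⟩ = (moduleOp ξ)⋆ (moduleOp η)` (`adjoint_moduleOp_comp`). The theorem thus becomes a Kaplansky
density theorem for the space `L` of the operators `v ↦ x ⊗ v` with `x ∈ H` (`opSpace`): every
contraction `moduleOp ξ` is a strong* limit of contractions in `L`. Strong* rather than strong
convergence is needed, because membership of `z` in a set `N_{η, ε, V}` centred at another point `η`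
involves the cross term `⟨z, η⟩`.

* `moduleOp ξ` is in the strong* closure of `L`. It is a norm limit of sums of products of elements
  of `L` with elements of `M`; and elements of `M` are strong* limits of elements of `A`, because for
  a linear space of operators the strong and strong* closures agree
  (`mem_strongStarClosure_of_strong`, proved with orthogonal complements).
* `L` is closed under `S₁ S₂⋆ S₃`, hence so is its strong* closure. If `‖T‖ < 1`, the equation
  `2S = T + SS⋆T` is solved by a contraction argument inside the strong* closure of `L`
  (`exists_cayley_preimage`), so that `T = 2S(1 + S⋆S)⁻¹`.
* If `x ∈ L` is strong* close to `S`, then `2x(1 + x⋆x)⁻¹` is a contraction, is strong* close to `T`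
  (`norm_cayley_sub_le`), and lies in `L` since `x⋆x(1 + x⋆x)⁻¹ ∈ A` (`cayley_mem_opSpace`).
-/

namespace HilbertExt

open ContinuousLinearMap Filter Topology

/-! ### The strong* closure of a set of operators between Hilbert spaces -/

section StrongStar

variable {E F E' F' : Type*}
  [NormedAddCommGroup E] [InnerProductSpace ℂ E] [CompleteSpace E]
  [NormedAddCommGroup F] [InnerProductSpace ℂ F] [CompleteSpace F]
  [NormedAddCommGroup E'] [InnerProductSpace ℂ E'] [CompleteSpace E']
  [NormedAddCommGroup F'] [InnerProductSpace ℂ F'] [CompleteSpace F']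

/-- An operator together with its adjoint, as a pair of plain functions. The product topology on
the target induces the strong* operator topology. -/
noncomputable def strongStarPair (T : E →L[ℂ] F) : (E → F) × (F → E) := (⇑T, ⇑(adjoint T))

/-- The closure of a set of operators in the strong* operator topology. -/
noncomputable def strongStarClosure (s : Set (E →L[ℂ] F)) : Set (E →L[ℂ] F) :=
  strongStarPair ⁻¹' closure (strongStarPair '' s)

theorem subset_strongStarClosure (s : Set (E →L[ℂ] F)) : s ⊆ strongStarClosure s :=
  fun _ hT => subset_closure (Set.mem_image_of_mem _ hT)

theorem continuous_strongStarPair :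
    Continuous (strongStarPair : (E →L[ℂ] F) → (E → F) × (F → E)) := by
  refine Continuous.prodMk (continuous_pi fun v => ?_) (continuous_pi fun k => ?_)
  · exact (ContinuousLinearMap.apply ℂ F v).continuous
  · exact (ContinuousLinearMap.apply ℂ E k).continuous.comp
      (adjoint : (E →L[ℂ] F) ≃ₗᵢ⋆[ℂ] (F →L[ℂ] E)).continuous

theorem isClosed_strongStarClosure (s : Set (E →L[ℂ] F)) : IsClosed (strongStarClosure s) :=
  isClosed_closure.preimage continuous_strongStarPair

/-- A transformation of operators that is continuous for the strong* topologies maps strong*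
closures into strong* closures. -/
theorem map_mem_strongStarClosure {Θ : (E →L[ℂ] F) → (E' →L[ℂ] F')}
    {θ : (E → F) × (F → E) → (E' → F') × (F' → E')} (hθ : Continuous θ)
    (h : ∀ S, strongStarPair (Θ S) = θ (strongStarPair S))
    {s : Set (E →L[ℂ] F)} {t : Set (E' →L[ℂ] F')} (hst : ∀ S ∈ s, Θ S ∈ strongStarClosure t)
    {T : E →L[ℂ] F} (hT : T ∈ strongStarClosure s) : Θ T ∈ strongStarClosure t := by
  have h1 := map_mem_closure hθ hT (t := closure (strongStarPair '' t)) (by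
    rintro _ ⟨S, hS, rfl⟩
    rw [← h]
    exact hst S hS)
  rw [closure_closure, ← h] at h1
  exact h1

theorem strongStarClosure_subset {s t : Set (E →L[ℂ] F)} (hst : s ⊆ strongStarClosure t) :
    strongStarClosure s ⊆ strongStarClosure t :=
  fun _ hT => map_mem_strongStarClosure (Θ := id) continuous_id (fun _ => rfl) hst hT

theorem add_mem_strongStarClosure (L : Submodule ℂ (E →L[ℂ] F)) {S T : E →L[ℂ] F}
    (hS : S ∈ strongStarClosure (L : Set (E →L[ℂ] F)))
    (hT : T ∈ strongStarClosure (L : Set (E →L[ℂ] F))) :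
    S + T ∈ strongStarClosure (L : Set (E →L[ℂ] F)) := by
  have h (S T : E →L[ℂ] F) :
      strongStarPair S + strongStarPair T = strongStarPair (S + T) := by
    ext <;> simp [strongStarPair]
  have h1 := map_mem_closure₂ continuous_add hS hT
    (u := strongStarPair '' (L : Set (E →L[ℂ] F))) (by
      rintro _ ⟨a, ha, rfl⟩ _ ⟨b, hb, rfl⟩
      exact ⟨a + b, L.add_mem ha hb, (h a b).symm⟩)
  rw [h] at h1
  exact h1

theorem comp_mem_strongStarClosure {s : Set (E →L[ℂ] F)} {t : Set (E' →L[ℂ] F')}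
    (P : F →L[ℂ] F') (Q : E' →L[ℂ] E)
    (hst : ∀ S ∈ s, P ∘L S ∘L Q ∈ strongStarClosure t) {T : E →L[ℂ] F}
    (hT : T ∈ strongStarClosure s) : P ∘L T ∘L Q ∈ strongStarClosure t := by
  refine map_mem_strongStarClosure (Θ := fun S => P ∘L S ∘L Q)
    (θ := fun f => (fun v => P (f.1 (Q v)), fun k => adjoint Q (f.2 (adjoint P k))))
    (by fun_prop) (fun S => ?_) hst hT
  simp only [strongStarPair, adjoint_comp]
  rfl

theorem comp_adjoint_mem_strongStarClosure {s : Set (E →L[ℂ] F)} {t : Set (E' →L[ℂ] F')}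
    (P : E →L[ℂ] F') (Q : E' →L[ℂ] F)
    (hst : ∀ S ∈ s, P ∘L adjoint S ∘L Q ∈ strongStarClosure t) {T : E →L[ℂ] F}
    (hT : T ∈ strongStarClosure s) : P ∘L adjoint T ∘L Q ∈ strongStarClosure t := by
  refine map_mem_strongStarClosure (Θ := fun S => P ∘L adjoint S ∘L Q)
    (θ := fun f => (fun v => P (f.2 (Q v)), fun k => adjoint Q (f.1 (adjoint P k))))
    (by fun_prop) (fun S => ?_) hst hT
  simp only [strongStarPair, adjoint_comp, adjoint_adjoint]
  rfl

theorem smul_mem_strongStarClosure (L : Submodule ℂ (E →L[ℂ] F)) (c : ℂ) {T : E →L[ℂ] F}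
    (hT : T ∈ strongStarClosure (L : Set (E →L[ℂ] F))) :
    c • T ∈ strongStarClosure (L : Set (E →L[ℂ] F)) :=
  comp_mem_strongStarClosure (c • ContinuousLinearMap.id ℂ F) (ContinuousLinearMap.id ℂ E)
    (fun _ hS => subset_strongStarClosure _ (L.smul_mem c hS)) hT

/-- Multiplication is only separately continuous in the strong* topology, so the three factors are
approximated one at a time. -/
theorem triple_mem_strongStarClosure {s : Set (E →L[ℂ] F)}
    (hs : ∀ S₁ ∈ s, ∀ S₂ ∈ s, ∀ S₃ ∈ s, S₁ ∘L adjoint S₂ ∘L S₃ ∈ s) {T₁ T₂ T₃ : E →L[ℂ] F}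
    (h₁ : T₁ ∈ strongStarClosure s) (h₂ : T₂ ∈ strongStarClosure s)
    (h₃ : T₃ ∈ strongStarClosure s) :
    T₁ ∘L adjoint T₂ ∘L T₃ ∈ strongStarClosure s := by
  refine comp_mem_strongStarClosure (ContinuousLinearMap.id ℂ F) (adjoint T₂ ∘L T₃)
    (fun S₁ hS₁ => ?_) h₁
  refine comp_adjoint_mem_strongStarClosure S₁ T₃ (fun S₂ hS₂ => ?_) h₂
  refine comp_mem_strongStarClosure (S₁ ∘L adjoint S₂) (ContinuousLinearMap.id ℂ E)
    (fun S₃ hS₃ => ?_) h₃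
  exact subset_strongStarClosure _ (hs S₁ hS₁ S₂ hS₂ S₃ hS₃)

theorem exists_finset_of_mem_nhds_pi {ι G : Type*} [SeminormedAddCommGroup G] {g : ι → G}
    {t : Set (ι → G)} (ht : t ∈ 𝓝 g) :
    ∃ U : Finset ι, ∃ ε > (0 : ℝ), ∀ f : ι → G, (∀ u ∈ U, ‖f u - g u‖ < ε) → f ∈ t := by
  rw [nhds_pi, Filter.mem_pi'] at ht
  obtain ⟨I, r, hr, hIt⟩ := ht
  choose e he hes using fun v => Metric.mem_nhds_iff.mp (hr v)
  obtain ⟨ε, hε, hle⟩ : ∃ ε > (0 : ℝ), ∀ v ∈ I, ε ≤ e v := by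
    rcases I.eq_empty_or_nonempty with h' | h'
    · exact ⟨1, one_pos, fun v hv => absurd hv (by simp [h'])⟩
    · exact ⟨I.inf' h' e, (Finset.lt_inf'_iff _).mpr fun v _ => he v,
        fun v hv => Finset.inf'_le _ hv⟩
  refine ⟨I, ε, hε, fun f hf => hIt fun v hv => hes v ?_⟩
  rw [Metric.mem_ball, dist_eq_norm]
  exact (hf v hv).trans_le (hle v hv)

theorem mem_strongStarClosure_of_forall {s : Set (E →L[ℂ] F)} {T : E →L[ℂ] F}
    (h : ∀ ε > (0 : ℝ), ∀ (U : Finset E) (W : Finset F), ∃ S ∈ s,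
      (∀ u ∈ U, ‖(S - T) u‖ < ε) ∧ ∀ k ∈ W, ‖adjoint (S - T) k‖ < ε) :
    T ∈ strongStarClosure s := by
  change strongStarPair T ∈ closure _
  rw [mem_closure_iff_nhds]
  intro t ht
  obtain ⟨t₁, ht₁, t₂, ht₂, hsub⟩ := mem_nhds_prod_iff.mp ht
  obtain ⟨U, e₁, he₁, hU⟩ := exists_finset_of_mem_nhds_pi ht₁
  obtain ⟨W, e₂, he₂, hW⟩ := exists_finset_of_mem_nhds_pi ht₂
  obtain ⟨S, hS, h1, h2⟩ := h (min e₁ e₂) (lt_min he₁ he₂) U W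
  refine ⟨_, hsub ⟨hU _ fun u hu => ?_, hW _ fun k hk => ?_⟩, S, hS, rfl⟩
  · simpa [strongStarPair] using (h1 u hu).trans_le (min_le_left _ _)
  · simpa [strongStarPair] using (h2 k hk).trans_le (min_le_right _ _)

theorem exists_tendsto_of_mem_strongStarClosure {ι : Type*} {g : ι → E →L[ℂ] F} {s : Set ι}
    {T : E →L[ℂ] F} (hT : T ∈ strongStarClosure (g '' s)) :
    ∃ l : Filter ι, l.NeBot ∧ (∀ᶠ x in l, x ∈ s) ∧
      (∀ v, Tendsto (fun x => g x v) l (𝓝 (T v))) ∧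
      ∀ k, Tendsto (fun x => adjoint (g x) k) l (𝓝 (adjoint T k)) := by
  have h1 : strongStarPair T ∈ closure ((fun x => strongStarPair (g x)) '' s) := by
    rw [← Set.image_image]
    exact hT
  refine ⟨comap (fun x => strongStarPair (g x)) (𝓝 (strongStarPair T)) ⊓ 𝓟 s, ?_,
    eventually_inf_principal.mpr (Eventually.of_forall fun _ h => h), fun v => ?_, fun k => ?_⟩
  · rw [neBot_inf_comap_iff_map', map_principal]
    exact mem_closure_iff_clusterPt.mp h1
  · have h2 : Tendsto (fun x => strongStarPair (g x)) (comap (fun x => strongStarPair (g x))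
      (𝓝 (strongStarPair T)) ⊓ 𝓟 s) (𝓝 (strongStarPair T)) := tendsto_comap.mono_left inf_le_left
    exact ((continuous_apply v).comp continuous_fst).continuousAt.tendsto.comp h2
  · have h2 : Tendsto (fun x => strongStarPair (g x)) (comap (fun x => strongStarPair (g x))
      (𝓝 (strongStarPair T)) ⊓ 𝓟 s) (𝓝 (strongStarPair T)) := tendsto_comap.mono_left inf_le_left
    exact ((continuous_apply k).comp continuous_snd).continuousAt.tendsto.comp h2

theorem exists_forall_of_mem_strongStarClosure {s : Set (E →L[ℂ] F)} {T : E →L[ℂ] F}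
    (hT : T ∈ strongStarClosure s) {ε : ℝ} (hε : 0 < ε) (U : Finset E) (W : Finset F) :
    ∃ S ∈ s, (∀ u ∈ U, ‖(S - T) u‖ < ε) ∧ ∀ k ∈ W, ‖adjoint (S - T) k‖ < ε := by
  obtain ⟨l, hl, h1, h2, h3⟩ :=
    exists_tendsto_of_mem_strongStarClosure (g := fun S : E →L[ℂ] F => S) (s := s) (T := T)
      (by simpa using hT)
  have h4 : ∀ᶠ S in l, ∀ u ∈ U, ‖(S - T) u‖ < ε :=
    (Filter.eventually_all_finset U).mpr fun u _ => by
      simpa [dist_eq_norm] using Metric.tendsto_nhds.mp (h2 u) ε hε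
  have h5 : ∀ᶠ S in l, ∀ k ∈ W, ‖adjoint (S - T) k‖ < ε :=
    (Filter.eventually_all_finset W).mpr fun k _ => by
      simpa [dist_eq_norm] using Metric.tendsto_nhds.mp (h3 k) ε hε
  obtain ⟨S, ha, hb, hc⟩ := (h1.and (h4.and h5)).exists
  exact ⟨S, ha, hb, hc⟩

open scoped RealInnerProductSpace in
/-- For a linear space of operators, strong approximation already gives strong* approximation. -/
theorem mem_strongStarClosure_of_strong (L : Submodule ℂ (E →L[ℂ] F)) {T : E →L[ℂ] F}
    (h : ∀ ε > (0 : ℝ), ∀ U : Finset E, ∃ S ∈ L, ∀ u ∈ U, ‖S u - T u‖ < ε) :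
    T ∈ strongStarClosure (L : Set (E →L[ℂ] F)) := by
  refine mem_strongStarClosure_of_forall fun ε hε U W => ?_
  let : InnerProductSpace ℝ E := InnerProductSpace.complexToReal
  let : InnerProductSpace ℝ F := InnerProductSpace.complexToReal
  -- The values at `U` and the adjoint values at `W` live in a real Hilbert space.
  let G : Type _ := WithLp 2 (PiLp 2 (fun _ : U => F) × PiLp 2 (fun _ : W => E))
  let Φ : (E →L[ℂ] F) →ₗ[ℝ] G :=
    { toFun := fun S => WithLp.toLp 2 (WithLp.toLp 2 fun u : U => S u,
        WithLp.toLp 2 fun k : W => adjoint S k)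
      map_add' := fun S S' => by
        apply WithLp.ofLp_injective 2; ext i <;> simp <;> rfl
      map_smul' := fun c S => by
        apply WithLp.ofLp_injective 2; ext i
        · simp; rfl
        · have : adjoint (c • S) = c • adjoint S := by
            have := (adjoint : (E →L[ℂ] F) ≃ₗᵢ⋆[ℂ] (F →L[ℂ] E)).map_smulₛₗ (c : ℂ) S
            simpa using this
          simp [this]; rfl }
  have hΦ (y : G) (S : E →L[ℂ] F) : ⟪y, Φ S⟫ =
      ∑ u : U, ⟪y.fst u, S u⟫ + ∑ k : W, ⟪(k : F), S (y.snd k)⟫ := by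
    have h2 (k : W) : ⟪y.snd k, adjoint S (k : F)⟫ = ⟪(k : F), S (y.snd k)⟫ := by
      rw [real_inner_comm, real_inner_eq_re_inner ℂ, real_inner_eq_re_inner ℂ,
        adjoint_inner_left]
    rw [← Finset.sum_congr rfl fun k _ => h2 k]
    rfl
  let N : Submodule ℝ G := (L.restrictScalars ℝ).map Φ
  have hmem : Φ T ∈ N.topologicalClosure := by
    rw [← Submodule.orthogonal_orthogonal_eq_closure, Submodule.mem_orthogonal]
    intro y hy
    -- A functional vanishing on `Φ L` depends on the values at finitely many vectors only.
    have hy0 (S) (hS : S ∈ L) : ⟪y, Φ S⟫ = 0 := by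
      rw [real_inner_comm]
      exact (Submodule.mem_orthogonal _ _).mp hy _ (Submodule.mem_map_of_mem hS)
    by_contra hne
    have hpos : 0 < |⟪y, Φ T⟫| := abs_pos.mpr hne
    set C : ℝ := ∑ u : U, ‖y.fst u‖ + ∑ k : W, ‖(k : F)‖ with hC
    have hC0 : 0 ≤ C := by positivity
    classical
    obtain ⟨S, hS, hST⟩ := h (|⟪y, Φ T⟫| / (C + 1)) (by positivity)
      (U ∪ Finset.univ.image fun k : W => y.snd k)
    have h1 : |⟪y, Φ T⟫| ≤ C * (|⟪y, Φ T⟫| / (C + 1)) := by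
      have h3 : ⟪y, Φ T⟫ = - ⟪y, Φ (S - T)⟫ := by
        rw [map_sub, inner_sub_right, hy0 S hS]; ring
      conv_lhs => rw [h3, abs_neg, hΦ]
      refine (abs_add_le _ _).trans ?_
      rw [hC, add_mul, Finset.sum_mul, Finset.sum_mul]
      refine add_le_add ((Finset.abs_sum_le_sum_abs _ _).trans (Finset.sum_le_sum fun u _ => ?_))
        ((Finset.abs_sum_le_sum_abs _ _).trans (Finset.sum_le_sum fun k _ => ?_))
      · refine (abs_real_inner_le_norm _ _).trans ?_
        gcongr
        exact (hST u (Finset.mem_union_left _ u.2)).le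
      · refine (abs_real_inner_le_norm _ _).trans ?_
        gcongr
        exact (hST _ (Finset.mem_union_right _ (Finset.mem_image_of_mem _ (Finset.mem_univ k)))).le
    have h2 : C * (|⟪y, Φ T⟫| / (C + 1)) < |⟪y, Φ T⟫| := by
      rw [mul_div_assoc', div_lt_iff₀ (by positivity)]
      nlinarith
    exact absurd h1 (not_le.mpr h2)
  obtain ⟨_, ⟨S, hS, rfl⟩, hd⟩ := Metric.mem_closure_iff.mp hmem ε hε
  rw [dist_comm, dist_eq_norm, ← map_sub] at hd
  refine ⟨S, hS, fun u hu => ?_, fun k hk => ?_⟩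
  · have h1 := (PiLp.norm_apply_le (Φ (S - T)).fst ⟨u, hu⟩).trans
      (WithLp.norm_fst_le _ (Φ (S - T)))
    exact h1.trans_lt hd
  · have h1 := (PiLp.norm_apply_le (Φ (S - T)).snd ⟨k, hk⟩).trans
      (WithLp.norm_snd_le _ (Φ (S - T)))
    exact h1.trans_lt hd

end StrongStar

/-! ### Kaplansky density for spaces of operators closed under `S₁ S₂⋆ S₃` -/

section Kaplansky

variable {E F : Type*}
  [NormedAddCommGroup E] [InnerProductSpace ℂ E] [CompleteSpace E]
  [NormedAddCommGroup F] [InnerProductSpace ℂ F] [CompleteSpace F]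

/-- The quantitative form of `‖(1 + xx⋆)⁻¹‖ ≤ 1` and `‖(1 + xx⋆)⁻¹x‖ ≤ 1`. -/
theorem norm_le_of_add_comp_adjoint_eq (x : E →L[ℂ] F) {d p : F} {q : E}
    (h : d + x (adjoint x d) = p + x q) : ‖d‖ ≤ ‖p‖ + ‖q‖ := by
  have h1 : ‖d‖ ^ 2 + ‖adjoint x d‖ ^ 2 ≤ ‖d‖ * ‖p‖ + ‖adjoint x d‖ * ‖q‖ := by
    calc ‖d‖ ^ 2 + ‖adjoint x d‖ ^ 2
        = (inner ℂ d (d + x (adjoint x d))).re := by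
          rw [inner_add_right, ← adjoint_inner_left, inner_self_eq_norm_sq_to_K,
            inner_self_eq_norm_sq_to_K, Complex.add_re]
          norm_cast
      _ = (inner ℂ d p).re + (inner ℂ (adjoint x d) q).re := by
          rw [h, inner_add_right, ← adjoint_inner_left, Complex.add_re]
      _ ≤ _ := add_le_add ((Complex.re_le_norm _).trans (norm_inner_le_norm _ _))
          ((Complex.re_le_norm _).trans (norm_inner_le_norm _ _))
  by_contra! hlt
  nlinarith [sq_nonneg (2 * ‖adjoint x d‖ - ‖q‖), norm_nonneg d, norm_nonneg p, norm_nonneg q]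

/-- If `C = 2x(1 + x⋆x)⁻¹` then `C` is a contraction. -/
theorem norm_le_one_of_cayley {x : E →L[ℂ] F} {R : E →L[ℂ] E}
    (hR : ∀ v, R v + adjoint x (x (R v)) = v) : ‖(2 : ℂ) • (x ∘L R)‖ ≤ 1 := by
  refine opNorm_le_bound _ zero_le_one fun v => ?_
  set w := R v with hw
  have h1 : ‖v‖ ^ 2 = ‖w‖ ^ 2 + 2 * ‖x w‖ ^ 2 + ‖adjoint x (x w)‖ ^ 2 := by
    conv_lhs => rw [← hR v, ← hw]
    rw [@norm_add_sq ℂ, ← adjoint_inner_left, adjoint_adjoint, inner_self_eq_norm_sq_to_K]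
    norm_cast
  have h2 : ‖x w‖ ^ 2 ≤ ‖w‖ * ‖adjoint x (x w)‖ := by
    calc ‖x w‖ ^ 2 = (inner ℂ w (adjoint x (x w))).re := by
          rw [adjoint_inner_right, inner_self_eq_norm_sq_to_K]
          norm_cast
      _ ≤ _ := (Complex.re_le_norm _).trans (norm_inner_le_norm _ _)
  have h3 : ‖((2 : ℂ) • (x ∘L R)) v‖ = 2 * ‖x w‖ := by
    simp [norm_smul, hw]
  rw [h3, one_mul, ← pow_le_pow_iff_left₀ (by positivity) (by positivity) two_ne_zero]
  nlinarith [sq_nonneg (‖w‖ - ‖adjoint x (x w)‖)]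

/-- Comparison of `C = 2(1 + xx⋆)⁻¹x` with `T = 2(1 + SS⋆)⁻¹S`: the difference is controlled by
`x - S` and its adjoint on vectors that depend only on `S` and `T`, not on `x`. -/
theorem norm_cayley_sub_le {x S C T : E →L[ℂ] F}
    (hC : ∀ v, C v + x (adjoint x (C v)) = (2 : ℂ) • x v)
    (hT : ∀ v, T v + S (adjoint S (T v)) = (2 : ℂ) • S v) (v : E) :
    ‖(C - T) v‖ ≤ ‖(x - S) ((2 : ℂ) • v - adjoint S (T v))‖ + ‖adjoint (x - S) (T v)‖ := by
  have h1 : (C - T) v + x (adjoint x ((C - T) v)) =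
      (x - S) ((2 : ℂ) • v - adjoint S (T v)) + x (-adjoint (x - S) (T v)) := by
    have h2 : (C - T) v + x (adjoint x ((C - T) v)) =
        (C v + x (adjoint x (C v))) - (T v + S (adjoint S (T v)))
          + (S (adjoint S (T v)) - x (adjoint x (T v))) := by
      simp only [sub_apply, map_sub]; abel
    rw [h2, hC, hT]
    simp only [sub_apply, map_sub, map_neg, map_smul, smul_sub]
    abel
  have h2 := norm_le_of_add_comp_adjoint_eq x h1
  rwa [norm_neg] at h2

/-- The equation `2S = T + SS⋆T` implies its mirror image `2S = T + TS⋆S`. -/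
theorem cayley_eq_symm {S T : E →L[ℂ] F}
    (hT : ∀ v, T v + S (adjoint S (T v)) = (2 : ℂ) • S v) (v : E) :
    T v + T (adjoint S (S v)) = (2 : ℂ) • S v := by
  have h1 : T (adjoint S (S v)) = S (adjoint S (T v)) := by
    have h2 := norm_le_of_add_comp_adjoint_eq S
      (d := T (adjoint S (S v)) - S (adjoint S (T v))) (p := 0) (q := 0) (by
        have h3 := hT (adjoint S (S v))
        have h4 := congrArg (fun y => S (adjoint S y)) (hT v)
        simp only [map_add, map_smul] at h4
        rw [← h4] at h3
        simp only [map_sub, map_zero, add_zero]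
        refine Eq.trans ?_ (sub_eq_zero.mpr h3)
        abel)
    simpa [sub_eq_zero] using h2
  rw [h1, hT]

theorem adjoint_cayley_eq {x C : E →L[ℂ] F}
    (hC : ∀ v, C v + C (adjoint x (x v)) = (2 : ℂ) • x v) (k : F) :
    adjoint C k + adjoint x (x (adjoint C k)) = (2 : ℂ) • adjoint x k := by
  have h1 : C + C ∘L adjoint x ∘L x = (2 : ℂ) • x := ContinuousLinearMap.ext hC
  have h2 : adjoint ((2 : ℂ) • x) = (2 : ℂ) • adjoint x := by
    rw [map_smulₛₗ, Complex.conj_ofNat]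
  have h3 := congrArg (fun Z => adjoint Z k) h1
  simpa [adjoint_comp, h2] using h3

/-- Every strict contraction is `2S(1 + S⋆S)⁻¹` for some `S`: such an `S` is a fixed point of
`S ↦ (T + SS⋆T)/2`, a strictly contracting map of the unit ball. -/
theorem exists_cayley_preimage {𝒞 : Set (E →L[ℂ] F)} (hclosed : IsClosed 𝒞)
    (h0 : (0 : E →L[ℂ] F) ∈ 𝒞) {T : E →L[ℂ] F} (hT1 : ‖T‖ < 1)
    (hstep : ∀ S ∈ 𝒞, (1 / 2 : ℂ) • (T + S ∘L adjoint S ∘L T) ∈ 𝒞) :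
    ∃ S ∈ 𝒞, ∀ v, T v + S (adjoint S (T v)) = (2 : ℂ) • S v := by
  let f : (E →L[ℂ] F) → (E →L[ℂ] F) := fun S => (1 / 2 : ℂ) • (T + S ∘L adjoint S ∘L T)
  let s : Set (E →L[ℂ] F) := 𝒞 ∩ Metric.closedBall 0 1
  have hadj (S : E →L[ℂ] F) : ‖adjoint S‖ = ‖S‖ := LinearIsometryEquiv.norm_map _ _
  have hs : IsComplete s := (hclosed.inter Metric.isClosed_closedBall).isComplete
  have hf : Set.MapsTo f s s := by
    rintro S ⟨hS, hS1⟩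
    refine ⟨hstep S hS, ?_⟩
    rw [mem_closedBall_zero_iff] at hS1 ⊢
    have h1 : ‖S ∘L adjoint S ∘L T‖ ≤ 1 :=
      calc ‖S ∘L adjoint S ∘L T‖ ≤ ‖S‖ * (‖adjoint S‖ * ‖T‖) :=
            (opNorm_comp_le _ _).trans (by gcongr; exact opNorm_comp_le _ _)
        _ ≤ 1 * (1 * 1) := by rw [hadj]; gcongr
        _ = 1 := by norm_num
    calc ‖f S‖ ≤ (1 / 2) * (‖T‖ + ‖S ∘L adjoint S ∘L T‖) := by
          simp only [f, norm_smul]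
          gcongr
          · norm_num
          · exact norm_add_le _ _
      _ ≤ 1 := by linarith
  have hK : ContractingWith ‖T‖₊ (hf.restrict f s s) := by
    refine ⟨by exact_mod_cast hT1, LipschitzWith.of_dist_le_mul ?_⟩
    rintro ⟨S, hS, hS1⟩ ⟨S', hS', hS1'⟩
    rw [mem_closedBall_zero_iff] at hS1 hS1'
    change dist (f S) (f S') ≤ ‖T‖ * dist S S'
    rw [dist_eq_norm, dist_eq_norm]
    have h1 : f S - f S' =
        (1 / 2 : ℂ) • (((S - S') ∘L adjoint S + S' ∘L adjoint (S - S')) ∘L T) := by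
      ext v
      simp only [f, sub_apply, smul_apply, add_apply, comp_apply, map_sub, ← smul_sub]
      congr 1; abel
    have h2 : ‖(S - S') ∘L adjoint S + S' ∘L adjoint (S - S')‖ ≤ 2 * ‖S - S'‖ := by
      calc _ ≤ ‖S - S'‖ * ‖adjoint S‖ + ‖S'‖ * ‖adjoint (S - S')‖ :=
            (norm_add_le _ _).trans (add_le_add (opNorm_comp_le _ _) (opNorm_comp_le _ _))
        _ ≤ ‖S - S'‖ * 1 + 1 * ‖S - S'‖ := by rw [hadj, hadj]; gcongr
        _ = _ := by ring
    rw [h1, norm_smul]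
    calc _ ≤ ‖(1 / 2 : ℂ)‖ * ((2 * ‖S - S'‖) * ‖T‖) := by
          gcongr
          exact (opNorm_comp_le _ _).trans (by gcongr)
      _ = ‖T‖ * ‖S - S'‖ := by norm_num; ring
  obtain ⟨S, hS, hfix, -⟩ := hK.exists_fixedPoint' hs hf (x := 0) ⟨h0, by simp⟩
    (edist_ne_top _ _)
  refine ⟨S, hS.1, fun v => ?_⟩
  have h1 : f S = S := hfix
  conv_rhs => rw [← h1]
  simp [f]

/-- **Kaplansky density.** Let `L` be a space of operators closed under `S₁ S₂⋆ S₃` and under the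
map `x ↦ 2x(1 + x⋆x)⁻¹`. Then every contraction in the strong* closure of `L` is in the strong*
closure of the set of contractions in `L`. -/
theorem mem_strongStarClosure_inter_closedBall (L : Submodule ℂ (E →L[ℂ] F))
    (htriple : ∀ S₁ ∈ L, ∀ S₂ ∈ L, ∀ S₃ ∈ L, S₁ ∘L adjoint S₂ ∘L S₃ ∈ L)
    (hcayley : ∀ x ∈ L, ∃ R : E →L[ℂ] E, (2 : ℂ) • (x ∘L R) ∈ L ∧
      (∀ v, R v + adjoint x (x (R v)) = v) ∧ ∀ v, R v + R (adjoint x (x v)) = v)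
    {T : E →L[ℂ] F} (hT : T ∈ strongStarClosure (L : Set (E →L[ℂ] F))) (hT1 : ‖T‖ ≤ 1) :
    T ∈ strongStarClosure ((L : Set (E →L[ℂ] F)) ∩ Metric.closedBall 0 1) := by
  have main {T : E →L[ℂ] F} (hT : T ∈ strongStarClosure (L : Set (E →L[ℂ] F)))
      (hT1 : ‖T‖ < 1) :
      T ∈ strongStarClosure ((L : Set (E →L[ℂ] F)) ∩ Metric.closedBall 0 1) := by
    obtain ⟨S, hS, hST⟩ := exists_cayley_preimage (isClosed_strongStarClosure L)
      (subset_strongStarClosure _ L.zero_mem) hT1 fun S hS =>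
        smul_mem_strongStarClosure L _ (add_mem_strongStarClosure L hT
          (triple_mem_strongStarClosure htriple hS hS hT))
    have hST' := adjoint_cayley_eq (cayley_eq_symm hST)
    refine mem_strongStarClosure_of_forall fun ε hε U W => ?_
    classical
    -- the vectors on which `x` has to be close to `S`, according to `norm_cayley_sub_le`
    obtain ⟨x, hx, hxU, hxW⟩ := exists_forall_of_mem_strongStarClosure hS (half_pos hε)
      (U.image (fun u => (2 : ℂ) • u - adjoint S (T u)) ∪ W.image (fun k => adjoint T k))
      (U.image (fun u => T u) ∪ W.image (fun k => (2 : ℂ) • k - S (adjoint T k)))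
    obtain ⟨R, hRL, hR, hR'⟩ := hcayley x hx
    have hC (v : E) : ((2 : ℂ) • (x ∘L R)) v + x (adjoint x (((2 : ℂ) • (x ∘L R)) v)) =
        (2 : ℂ) • x v := by
      conv_rhs => rw [← hR v]
      simp
    have hC' := adjoint_cayley_eq (x := x) (C := (2 : ℂ) • (x ∘L R)) fun v => by
      conv_rhs => rw [← hR' v]
      simp
    refine ⟨_, ⟨hRL, by simpa using norm_le_one_of_cayley hR⟩, fun u hu => ?_, fun k hk => ?_⟩
    · refine (norm_cayley_sub_le hC hST u).trans_lt ?_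
      have h1 := hxU _ (Finset.mem_union_left _ (Finset.mem_image_of_mem _ hu))
      have h2 := hxW _ (Finset.mem_union_left _ (Finset.mem_image_of_mem _ hu))
      linarith
    · have h0 := norm_cayley_sub_le (x := adjoint x) (S := adjoint S)
        (C := adjoint ((2 : ℂ) • (x ∘L R))) (T := adjoint T)
        (fun k => by simpa only [adjoint_adjoint] using hC' k)
        (fun k => by simpa only [adjoint_adjoint] using hST' k) k
      simp only [← map_sub, adjoint_adjoint] at h0
      refine h0.trans_lt ?_
      have h1 := hxW _ (Finset.mem_union_right _ (Finset.mem_image_of_mem _ hk))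
      have h2 := hxU _ (Finset.mem_union_right _ (Finset.mem_image_of_mem _ hk))
      linarith
  have h1 : T ∈ closure (Metric.ball (0 : E →L[ℂ] F) 1 ∩
      strongStarClosure (L : Set (E →L[ℂ] F))) := by
    -- `T` is the limit of its multiples `r T`, `r < 1`
    have h2 : Tendsto (fun r : ℝ => (r : ℂ) • T) (𝓝[<] 1) (𝓝 T) := by
      have : Continuous fun r : ℝ => (r : ℂ) • T := by fun_prop
      simpa using (this.tendsto 1).mono_left nhdsWithin_le_nhds
    refine mem_closure_of_tendsto h2 ?_
    filter_upwards [Ioo_mem_nhdsLT (zero_lt_one (α := ℝ))] with r hr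
    refine ⟨?_, smul_mem_strongStarClosure L _ hT⟩
    rw [mem_ball_zero_iff, norm_smul, Complex.norm_real, Real.norm_of_nonneg hr.1.le]
    nlinarith [hr.1, hr.2, norm_nonneg T]
  exact closure_minimal (fun S hS => main hS.2 (by simpa using hS.1))
    (isClosed_strongStarClosure _) h1

end Kaplansky

/-! ### The Hilbert space `H ⊗_A X` and the operators attached to elements of `H • M` -/

section Representation

variable {X : Type*} [NormedAddCommGroup X] [InnerProductSpace ℂ X] [CompleteSpace X]
variable (A : NonUnitalStarSubalgebra ℂ (X →L[ℂ] X))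
variable {H : Type*} [NormedAddCommGroup H] [NormedSpace ℂ H] [SMul (↥A)ᵐᵒᵖ H]
  [CStarModule (↥A)ᵐᵒᵖ H]

variable (H) in
/-- The algebraic tensor product `H ⊗ X` over `ℂ`, to carry the seminorm coming from the
form `⟨x ⊗ u, y ⊗ v⟩ = ⟨u, ⟨x, y⟩ v⟩`. -/
def VecTensor (_ : NonUnitalStarSubalgebra ℂ (X →L[ℂ] X)) : Type _ := H ⊗[ℂ] X

instance : AddCommGroup (VecTensor H A) := inferInstanceAs (AddCommGroup (H ⊗[ℂ] X))

instance : Module ℂ (VecTensor H A) := inferInstanceAs (Module ℂ (H ⊗[ℂ] X))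

theorem evalVec_add (z : AlgTensor A H) (u v : X) :
    evalVec A (u + v) z = evalVec A u z + evalVec A v z := by
  induction z using AlgTensor.induction with
  | h0 => simp
  | h1 x b =>
    change x ⊗ₜ[ℂ] ((b : X →L[ℂ] X) (u + v)) =
      x ⊗ₜ[ℂ] ((b : X →L[ℂ] X) u) + x ⊗ₜ[ℂ] ((b : X →L[ℂ] X) v)
    rw [map_add, TensorProduct.tmul_add]
  | h2 z w hz hw => rw [map_add, map_add, map_add, hz, hw]; abel

theorem evalVec_smul (c : ℂ) (z : AlgTensor A H) (v : X) :
    evalVec A (c • v) z = c • evalVec A v z := by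
  induction z using AlgTensor.induction with
  | h0 => simp
  | h1 x b =>
    change x ⊗ₜ[ℂ] ((b : X →L[ℂ] X) (c • v)) = c • x ⊗ₜ[ℂ] ((b : X →L[ℂ] X) v)
    rw [map_smul, TensorProduct.tmul_smul]
  | h2 z w hz hw => rw [map_add, map_add, hz, hw, smul_add]

theorem mem_sotClosure_of_mem {a : X →L[ℂ] X} (ha : a ∈ A) : a ∈ sotClosure A :=
  (mem_sotClosure_iff A a).mpr fun ε hε _ => ⟨a, ha, fun v _ => by simpa using hε⟩

theorem opInner_op_smul_right (a : A) (x y : H) :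
    opInner A x (MulOpposite.op a • y) = opInner A x y * (a : X →L[ℂ] X) := by
  simp [opInner]

theorem opInner_op_smul_left (a : A) (x y : H) :
    opInner A (MulOpposite.op a • x) y = star (a : X →L[ℂ] X) * opInner A x y := by
  simp [opInner]

variable [IsClosed (A : Set (X →L[ℂ] X))]

variable (H) in
/-- The positive semidefinite form on `H ⊗ X`. -/
@[reducible]
noncomputable def vecCore : PreInnerProductSpace.Core ℂ (VecTensor H A) where
  inner s t := vecForm (H := H) A s t
  conj_inner_symm s t := vecForm_symm (H := H) A s t
  re_inner_nonneg s := vecForm_self_nonneg (H := H) A s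
  add_left s s' t := LinearMap.map_add₂ (vecForm (H := H) A) s s' t
  smul_left s t c := by
    change vecForm (H := H) A (c • s) t = _
    exact LinearMap.map_smulₛₗ₂ (vecForm (H := H) A) c s t

noncomputable instance : SeminormedAddCommGroup (VecTensor H A) :=
  @InnerProductSpace.Core.toSeminormedAddCommGroup ℂ _ _ _ _ (vecCore A H)

noncomputable instance : InnerProductSpace ℂ (VecTensor H A) :=
  InnerProductSpace.ofCore (vecCore A H)

variable (H) in
/-- The interior tensor product `H ⊗_A X`: the Hilbert space completion of `H ⊗ X`. -/
abbrev VecSpace : Type _ := UniformSpace.Completion (VecTensor H A)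

/-- The map `H ⊗ X → H ⊗_A X`. -/
noncomputable def vecCoe : VecTensor H A →L[ℂ] VecSpace A H := UniformSpace.Completion.toComplL

theorem inner_vecCoe (s t : H ⊗[ℂ] X) :
    inner ℂ (vecCoe (H := H) A s) (vecCoe A t) = vecForm A s t :=
  UniformSpace.Completion.inner_coe (𝕜 := ℂ) (E := VecTensor H A) s t

theorem norm_vecCoe_evalVec_le (z : AlgTensor A H) (v : X) :
    ‖vecCoe (H := H) A (evalVec A v z)‖ ≤ ‖z‖ * ‖v‖ := by
  have hz := algTensor_norm_nonneg A z
  refine (pow_le_pow_iff_left₀ (norm_nonneg _) (by positivity) two_ne_zero).mp ?_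
  rw [← inner_self_eq_norm_sq (𝕜 := ℂ), inner_vecCoe]
  exact vecForm_evalVec_le A z v

/-- The map `z ↦ (v ↦ evalVec v z)`. -/
noncomputable def evalLin : AlgTensor A H →ₗ[ℂ] X →ₗ[ℂ] VecTensor H A :=
  LinearMap.mk₂ ℂ (fun z v => evalVec A v z) (fun z w _ => map_add _ z w)
    (fun c z _ => map_smul _ c z) (evalVec_add A) (fun c z v => evalVec_smul A c z v)

/-- The operator `v ↦ z v` from `X` to `H ⊗_A X` attached to `z ∈ H ⊗ M`. -/
noncomputable def algOp : AlgTensor A H →L[ℂ] X →L[ℂ] VecSpace A H :=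
  LinearMap.mkContinuous₂
    ((LinearMap.compr₂ (evalLin A) (vecCoe (H := H) A).toLinearMap)) 1
    fun z v => by rw [one_mul]; exact norm_vecCoe_evalVec_le A z v

/-- The operator `v ↦ ξ v` from `X` to `H ⊗_A X` attached to `ξ ∈ H • M`. -/
noncomputable def moduleOp : Ext A H →L[ℂ] X →L[ℂ] VecSpace A H :=
  (algOp A).extend (UniformSpace.Completion.toComplL (𝕜 := ℂ) (E := AlgTensor A H))

theorem moduleOp_coe (z : AlgTensor A H) : moduleOp A (z : Ext A H) = algOp A z :=
  ContinuousLinearMap.extend_eq _ UniformSpace.Completion.denseRange_coe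
    (UniformSpace.Completion.isUniformInducing_coe _) z

theorem moduleOp_coe_apply (z : AlgTensor A H) (v : X) :
    moduleOp A (z : Ext A H) v = vecCoe (H := H) A (evalVec A v z) := by
  rw [moduleOp_coe]; rfl

theorem adjoint_moduleOp_comp (ζ ω : Ext A H) :
    adjoint (moduleOp A ζ) ∘L moduleOp A ω = inner (X →L[ℂ] X) ζ ω := by
  induction ζ, ω using UniformSpace.Completion.induction_on₂ with
  | hp =>
    refine isClosed_eq ?_ (continuous_inner A)
    have h1 : Continuous fun p : Ext A H × Ext A H => adjoint (moduleOp A p.1) :=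
      (adjoint : (X →L[ℂ] VecSpace A H) ≃ₗᵢ⋆[ℂ] _).continuous.comp
        ((moduleOp A).continuous.comp continuous_fst)
    exact h1.clm_comp ((moduleOp A).continuous.comp continuous_snd)
  | ih z w =>
    rw [inner_coe]
    ext v
    refine ext_inner_left ℂ fun u => ?_
    rw [comp_apply, adjoint_inner_right, moduleOp_coe_apply, moduleOp_coe_apply, inner_vecCoe,
      inner_tensorInner]

theorem adjoint_moduleOp_apply (ζ ω : Ext A H) (v : X) :
    adjoint (moduleOp A ζ) (moduleOp A ω v) = inner (X →L[ℂ] X) ζ ω v := by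
  rw [← adjoint_moduleOp_comp]; rfl

theorem norm_moduleOp (ζ : Ext A H) : ‖moduleOp A ζ‖ = ‖ζ‖ := by
  refine (pow_left_inj₀ (norm_nonneg (moduleOp A ζ)) (norm_nonneg ζ) two_ne_zero).mp ?_
  rw [norm_sq_ext, ← adjoint_moduleOp_comp, norm_adjoint_comp_self, sq]

/-! ### The space of operators attached to `H` -/

variable (h1 : (1 : X →L[ℂ] X) ∈ sotClosure A)

theorem moduleOp_tmul (x : H) (b : sotClosure A) :
    moduleOp A (tmul A x b : Ext A H) = moduleOp A (embed A h1 x) ∘L (b : X →L[ℂ] X) := by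
  ext v
  change moduleOp A ((tmul A x b : AlgTensor A H) : Ext A H) v =
    moduleOp A ((tmul A x ⟨1, h1⟩ : AlgTensor A H) : Ext A H) ((b : X →L[ℂ] X) v)
  rw [moduleOp_coe_apply, moduleOp_coe_apply]
  rfl

theorem adjoint_moduleOp_embed_apply (x y : H) (v : X) :
    adjoint (moduleOp A (embed A h1 x)) (moduleOp A (embed A h1 y) v) = opInner A x y v := by
  rw [adjoint_moduleOp_apply]
  have h2 := inner_coe A (tmul A x ⟨1, h1⟩) (tmul A y ⟨1, h1⟩)
  rw [tensorInner_tmul, star_one, one_mul, mul_one] at h2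
  exact congrArg (fun Z : X →L[ℂ] X => Z v) h2

/-- In `H • M` one has `x ⊗ a = x a ⊗ 1` for `a ∈ A`. -/
theorem moduleOp_embed_comp (x : H) (a : A) :
    moduleOp A (embed A h1 x) ∘L (a : X →L[ℂ] X) =
      moduleOp A (embed A h1 (MulOpposite.op a • x)) := by
  rw [← moduleOp_tmul A h1 x ⟨a, mem_sotClosure_of_mem A a.2⟩]
  congr 1
  rw [← sub_eq_zero, ← norm_eq_zero]
  change ‖((tmul A x ⟨a, mem_sotClosure_of_mem A a.2⟩ : AlgTensor A H) : Ext A H) -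
    ((tmul A (MulOpposite.op a • x) ⟨1, h1⟩ : AlgTensor A H) : Ext A H)‖ = 0
  rw [← UniformSpace.Completion.coe_sub, UniformSpace.Completion.norm_coe,
    ← pow_eq_zero_iff two_ne_zero, norm_sq_algTensor, norm_eq_zero]
  simp [tensorInner_tmul, opInner_op_smul_right, opInner_op_smul_left, mul_assoc]

variable (H) in
/-- The operators `v ↦ x ⊗ v` with `x ∈ H`. -/
noncomputable def opSpace : Submodule ℂ (X →L[ℂ] VecSpace A H) :=
  LinearMap.range ((moduleOp A).toLinearMap ∘ₗ (embed (H := H) A h1).toLinearMap)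

theorem mem_opSpace (x : H) : moduleOp A (embed A h1 x) ∈ opSpace A H h1 := ⟨x, rfl⟩

theorem triple_mem_opSpace (S₁ : X →L[ℂ] VecSpace A H) (hS₁ : S₁ ∈ opSpace A H h1)
    (S₂ : X →L[ℂ] VecSpace A H) (hS₂ : S₂ ∈ opSpace A H h1)
    (S₃ : X →L[ℂ] VecSpace A H) (hS₃ : S₃ ∈ opSpace A H h1) :
    S₁ ∘L adjoint S₂ ∘L S₃ ∈ opSpace A H h1 := by
  obtain ⟨x₁, rfl⟩ := hS₁
  obtain ⟨x₂, rfl⟩ := hS₂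
  obtain ⟨x₃, rfl⟩ := hS₃
  have h2 : adjoint (moduleOp A (embed A h1 x₂)) ∘L moduleOp A (embed A h1 x₃) =
      ((inner (↥A)ᵐᵒᵖ x₂ x₃).unop : X →L[ℂ] X) :=
    ContinuousLinearMap.ext fun v => adjoint_moduleOp_embed_apply A h1 x₂ x₃ v
  change moduleOp A (embed A h1 x₁) ∘L adjoint (moduleOp A (embed A h1 x₂)) ∘L
    moduleOp A (embed A h1 x₃) ∈ _
  rw [h2, moduleOp_embed_comp]
  exact mem_opSpace A h1 _

/-- The quasi-inverse `b = a(1 + a)⁻¹` of a positive element, which exists without a unit. -/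
theorem exists_quasi_inverse {B : Type*} [NonUnitalCStarAlgebra B] [PartialOrder B]
    [StarOrderedRing B] {a : B} (ha : 0 ≤ a) : ∃ b : B, b + a * b = a ∧ b + b * a = a := by
  let f : ℝ → ℝ := fun t => t / (1 + |t|)
  have hf : Continuous f := by
    refine continuous_id.div (by fun_prop) fun t => ?_
    positivity
  have hf0 : f 0 = 0 := by simp [f]
  have hsa : IsSelfAdjoint a := ha.isSelfAdjoint
  have h2 : cfcₙ f a + a * cfcₙ f a = a := by
    conv_lhs => enter [2, 1]; rw [← cfcₙ_id' ℝ a]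
    conv_rhs => rw [← cfcₙ_id' ℝ a]
    rw [← cfcₙ_mul (fun t : ℝ => t) f a (by fun_prop) rfl hf.continuousOn hf0,
      ← cfcₙ_add f (fun t => t * f t) a hf.continuousOn hf0
        (continuous_id.mul hf).continuousOn (by simp)]
    refine cfcₙ_congr fun t ht => ?_
    have ht0 : 0 ≤ t := quasispectrum_nonneg_of_nonneg _ ha t ht
    simp only [f, abs_of_nonneg ht0]
    field_simp
  have h3 : Commute a (cfcₙ f a) := by
    have := cfcₙ_commute_cfcₙ (fun t : ℝ => t) f a
    rwa [cfcₙ_id' ℝ a] at this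
  exact ⟨cfcₙ f a, h2, by rw [← h3.eq, h2]⟩

/-- `H` is stable under `x ↦ 2x(1 + ⟨x, x⟩)⁻¹`. -/
theorem cayley_mem_opSpace (S : X →L[ℂ] VecSpace A H) (hS : S ∈ opSpace A H h1) :
    ∃ R : X →L[ℂ] X, (2 : ℂ) • (S ∘L R) ∈ opSpace A H h1 ∧
      (∀ v, R v + adjoint S (S (R v)) = v) ∧ ∀ v, R v + R (adjoint S (S v)) = v := by
  obtain ⟨x, rfl⟩ := hS
  have ha : 0 ≤ (inner (↥A)ᵐᵒᵖ x x).unop :=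
    (MulOpposite.unop_nonneg (α := A)).mpr (CStarModule.inner_self_nonneg (A := (↥A)ᵐᵒᵖ))
  obtain ⟨b, hb, hb'⟩ := exists_quasi_inverse ha
  have e1 (v : X) : (b : X →L[ℂ] X) v + opInner A x x ((b : X →L[ℂ] X) v) = opInner A x x v :=
    congrArg (fun Z : A => (Z : X →L[ℂ] X) v) hb
  have e2 (v : X) : (b : X →L[ℂ] X) v + (b : X →L[ℂ] X) (opInner A x x v) = opInner A x x v :=
    congrArg (fun Z : A => (Z : X →L[ℂ] X) v) hb'
  refine ⟨1 - (b : X →L[ℂ] X), Submodule.smul_mem _ _ ?_, fun v => ?_, fun v => ?_⟩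
  · change moduleOp A (embed A h1 x) ∘L (1 - (b : X →L[ℂ] X)) ∈ _
    rw [comp_sub, moduleOp_embed_comp]
    exact Submodule.sub_mem _ (mem_opSpace A h1 x) (mem_opSpace A h1 _)
  · change _ + adjoint (moduleOp A (embed A h1 x)) (moduleOp A (embed A h1 x) _) = v
    rw [adjoint_moduleOp_embed_apply]
    simp only [sub_apply, one_apply_eq_self, map_sub]
    rw [← e1 v]; abel
  · change _ + (1 - (b : X →L[ℂ] X))
      (adjoint (moduleOp A (embed A h1 x)) (moduleOp A (embed A h1 x) v)) = v
    rw [adjoint_moduleOp_embed_apply]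
    simp only [sub_apply, one_apply_eq_self]
    nth_rewrite 1 [← e2 v]
    abel

theorem moduleOp_mem_strongStarClosure (ξ : Ext A H) :
    moduleOp A ξ ∈ strongStarClosure (opSpace A H h1 : Set (X →L[ℂ] VecSpace A H)) := by
  induction ξ using UniformSpace.Completion.induction_on with
  | hp => exact (isClosed_strongStarClosure _).preimage (moduleOp A).continuous
  | ih z =>
    induction z using AlgTensor.induction with
    | h0 =>
      rw [UniformSpace.Completion.coe_zero, map_zero]
      exact subset_strongStarClosure _ (Submodule.zero_mem _)
    | h2 z w hz hw =>
      rw [UniformSpace.Completion.coe_add, map_add]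
      exact add_mem_strongStarClosure _ hz hw
    | h1 x b =>
      rw [moduleOp_tmul A h1]
      refine comp_mem_strongStarClosure
        (s := (A.toNonUnitalSubalgebra.toSubmodule : Set (X →L[ℂ] X)))
        (moduleOp A (embed A h1 x)) (ContinuousLinearMap.id ℂ X) (fun a ha => ?_)
        (mem_strongStarClosure_of_strong _ ((mem_sotClosure_iff A b).mp b.2))
      refine subset_strongStarClosure _ ?_
      rw [comp_id, moduleOp_embed_comp A h1 x ⟨a, ha⟩]
      exact mem_opSpace A h1 _

/-- Every `ξ` in the unit ball of `H • M` is a strong* limit of the unit ball of `H`. -/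
theorem exists_filter_tendsto (ξ : Ext A H) (hξ : ‖ξ‖ ≤ 1) :
    ∃ l : Filter H, l.NeBot ∧ (∀ᶠ x in l, x ∈ Metric.closedBall (0 : H) 1) ∧
      (∀ v, Tendsto (fun x => moduleOp A (embed A h1 x) v) l (𝓝 (moduleOp A ξ v))) ∧
      ∀ k, Tendsto (fun x => adjoint (moduleOp A (embed A h1 x)) k) l
        (𝓝 (adjoint (moduleOp A ξ) k)) := by
  refine exists_tendsto_of_mem_strongStarClosure (strongStarClosure_subset (fun S hS => ?_)
    (mem_strongStarClosure_inter_closedBall (opSpace A H h1) (triple_mem_opSpace A h1)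
      (cayley_mem_opSpace A h1) (moduleOp_mem_strongStarClosure A h1 ξ)
      (by rwa [norm_moduleOp])))
  obtain ⟨⟨x, rfl⟩, hx⟩ := hS
  refine subset_strongStarClosure _ ⟨x, ?_, rfl⟩
  have h2 : ‖moduleOp A (embed A h1 x)‖ ≤ 1 := mem_closedBall_zero_iff.mp hx
  rwa [norm_moduleOp, LinearIsometry.norm_map, ← mem_closedBall_zero_iff] at h2

/-- Along a bounded strong* convergent filter, `⟨η - x, η - x⟩` converges strongly for every `η`.
Convergence of the adjoints is what handles the cross term `⟨x, η⟩`. -/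
theorem tendsto_inner_sub {l : Filter H} {ξ : Ext A H}
    (hl : ∀ᶠ x in l, x ∈ Metric.closedBall (0 : H) 1)
    (hs : ∀ v, Tendsto (fun x => moduleOp A (embed A h1 x) v) l (𝓝 (moduleOp A ξ v)))
    (hs' : ∀ k, Tendsto (fun x => adjoint (moduleOp A (embed A h1 x)) k) l
        (𝓝 (adjoint (moduleOp A ξ) k))) (η : Ext A H) (v : X) :
    Tendsto (fun x => inner (X →L[ℂ] X) (η - embed A h1 x) (η - embed A h1 x) v) l
      (𝓝 (inner (X →L[ℂ] X) (η - ξ) (η - ξ) v)) := by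
  have e (x : H) : inner (X →L[ℂ] X) (η - embed A h1 x) (η - embed A h1 x) v =
      adjoint (moduleOp A (η - embed A h1 x)) (moduleOp A (η - ξ) v) +
        adjoint (moduleOp A (η - embed A h1 x)) (moduleOp A (ξ - embed A h1 x) v) := by
    rw [← map_add, ← add_apply, ← map_add, sub_add_sub_cancel, adjoint_moduleOp_apply]
  simp only [e]
  rw [← adjoint_moduleOp_apply, ← add_zero (adjoint (moduleOp A (η - ξ)) _)]
  refine Tendsto.add ?_ ?_
  · simpa only [map_sub (moduleOp A), map_sub adjoint, sub_apply] using
      (tendsto_const_nhds (x := adjoint (moduleOp A η) (moduleOp A (η - ξ) v))).sub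
        (hs' (moduleOp A (η - ξ) v))
  · refine squeeze_zero_norm' (a := fun x => (‖η‖ + 1) * ‖moduleOp A (ξ - embed A h1 x) v‖) ?_ ?_
    · filter_upwards [hl] with x hx
      refine (le_opNorm _ _).trans ?_
      gcongr
      rw [LinearIsometryEquiv.norm_map, norm_moduleOp]
      refine (norm_sub_le _ _).trans ?_
      rw [LinearIsometry.norm_map]
      gcongr
      exact mem_closedBall_zero_iff.mp hx
    · have h2 : Tendsto (fun x => moduleOp A (ξ - embed A h1 x) v) l (𝓝 0) := by
        simpa only [map_sub (moduleOp A), sub_apply, sub_self] using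
          (tendsto_const_nhds (x := moduleOp A ξ v)).sub (hs v)
      simpa using h2.norm.const_mul (‖η‖ + 1)

end Representation
end HilbertExt

open Filter Topology in
theorem mainTheorem6
    {X : Type*} [NormedAddCommGroup X] [InnerProductSpace ℂ X] [CompleteSpace X]
    (A : NonUnitalStarSubalgebra ℂ (X →L[ℂ] X))
    {H : Type*} [NormedAddCommGroup H] [NormedSpace ℂ H] [CompleteSpace H]
    [SMul (↥A)ᵐᵒᵖ H] [CStarModule (↥A)ᵐᵒᵖ H]
    [IsClosed (A : Set (X →L[ℂ] X))]
    (h1 : (1 : X →L[ℂ] X) ∈ HilbertExt.sotClosure A) :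
    (Metric.closedBall (0 : HilbertExt.Ext A H) 1 ⊆
      closure[HilbertExt.topologyTs A H]
        (HilbertExt.embed A h1 '' Metric.closedBall (0 : H) 1)) ∧
    (∀ ξ : HilbertExt.Ext A H, ‖ξ‖ ≤ 1 →
      ∃ l : Filter H, l.NeBot ∧ (∀ᶠ x in l, ‖x‖ ≤ 1) ∧
        ∀ v : X, Tendsto
          (fun x : H => inner (X →L[ℂ] X)
            (ξ - HilbertExt.embed A h1 x) (ξ - HilbertExt.embed A h1 x) v)
          l (𝓝 0)) := by
  constructor
  · intro ξ hξ
    obtain ⟨l, hl, hball, hs, hs'⟩ :=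
      HilbertExt.exists_filter_tendsto A h1 ξ (mem_closedBall_zero_iff.mp hξ)
    have hlim : Tendsto (fun x => HilbertExt.embed A h1 x) l
        (@nhds _ (HilbertExt.topologyTs A H) ξ) := by
      refine TopologicalSpace.tendsto_nhds_generateFrom_iff.mpr ?_
      rintro _ ⟨η, ε, hε, V, rfl⟩ hmem
      refine (Filter.eventually_all_finset V).mpr fun v hv => ?_
      exact (HilbertExt.tendsto_inner_sub A h1 hball hs hs' η v).norm.eventually_lt_const
        (hmem v hv)
    exact @mem_closure_of_tendsto _ (HilbertExt.topologyTs A H) _ _ _ _ _ hl hlim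
      (hball.mono fun x hx => Set.mem_image_of_mem _ hx)
  · intro ξ hξ
    obtain ⟨l, hl, hball, hs, hs'⟩ := HilbertExt.exists_filter_tendsto A h1 ξ hξ
    refine ⟨l, hl, hball.mono fun x hx => mem_closedBall_zero_iff.mp hx, fun v => ?_⟩
    have h2 := HilbertExt.tendsto_inner_sub A h1 hball hs hs' ξ v
    have h3 : inner (X →L[ℂ] X) (ξ - ξ) (ξ - ξ) v = 0 := by
      rw [← HilbertExt.adjoint_moduleOp_apply, sub_self, map_zero]
      simp
    rwa [h3] at h2
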